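/- **Setting.** A classical query model consists of a finite set of oracles, a set of queries, a set of answers, and an answer $\mathrm{ans}(f,q)$ for each oracle $f$ and query $q$; the basic example is that of functions $f\colon[M]\to[N]$ with queries $x\in[M]$ and answers $f(x)$. A game $G$ in such a model is given by a probability distribution $\mu$ on oracles, a discrete challenge distribution $\pi_f$ for each oracle $f$, and a set $\mathcal R_{f,\mathsf{ch}}$ of accepted outcomes for each oracle $f$ and challenge $\mathsf{ch}$. A (possibly randomized, adaptive) query algorithm $\mathcal A$ is given $\mathsf{ch}$ and query access to $f$, and wins if its output lies in $\mathcal R_{f,\mathsf{ch}}$; its winning probability is taken over $f\sim\mu$, $\mathsf{ch}\sim\pi_f$ and its internal randomness. For $S,T\in\mathbb N$, $\varepsilon_G(T)$ denotes the optimal (supremum) winning probability of algorithms that make at most $T$ queries, and $\varepsilon_G(S,T)$ denotes the optimal winning probability when the algorithm in addition receives an $S$-bit advice string $\sigma_f\in\{0,1\}^S$ that may depend arbitrarily on $f$ but not on $\mathsf{ch}$. For an integer $K\ge1$, the salted game $G_K$ has as oracle a tuple $g=(f_1,\dots,f_K)$ of independent samples from $\mu$; a query is a pair $(i,q)$ with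 $i\in[K]$ and is answered by $\mathrm{ans}(f_i,q)$; the challenge is $(k,\mathsf{ch}_k)$ with $k$ uniform in $[K]$ and $\mathsf{ch}_k\sim\pi_{f_k}$; and the set of accepted outcomes is $\mathcal R_{f_k,\mathsf{ch}_k}$. **Theorem.** Let $G$ be a game in a classical query model and let $G_K$ be its salted version, where $K\ge1$ is an integer. Then for all $S,T\in\mathbb N$, $$\varepsilon_{G_K}(S,T)\;\le\;\min_{L\in\mathbb Z,\ L\ge1}\;2^{S/L}\cdot\Bigl(\varepsilon_G(T)+\frac LK\Bigr).$$ -/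

import Mathlib

open scoped ENNReal

/-- A deterministic classical query algorithm: an adaptive decision tree which at each step either
stops with an outcome, or asks a query and continues depending on the answer received. -/
inductive QueryAlg (Query Answer Outcome : Type*) where
  | output (o : Outcome) : QueryAlg Query Answer Outcome
  | query (q : Query) (next : Answer → QueryAlg Query Answer Outcome) :
      QueryAlg Query Answer Outcome

namespace QueryAlg

variable {Query Answer Outcome : Type*}

/-- The outcome of the algorithm when each query `q` is answered by `f q`. -/
def run (f : Query → Answer) : QueryAlg Query Answer Outcome → Outcome
  | output o => o
  | query q next => run f (next (f q))

/-- In every execution the algorithm makes at most the given number of queries. -/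
def MakesAtMost : QueryAlg Query Answer Outcome → ℕ → Prop
  | output _, _ => True
  | query _ _, 0 => False
  | query _ next, T + 1 => ∀ a, MakesAtMost (next a) T

end QueryAlg

/-- A game in a classical query model. An oracle `f` is accessed through queries `q`, answered by
`answer f q`; the basic case is that of oracles which are functions `f : Query → Answer`, with
`answer f q = f q`. A game consists of a distribution of oracles, a challenge distribution for
each oracle, and a set of accepted outcomes for each oracle and challenge. -/
structure Game (Oracle Query Answer Challenge Outcome : Type*) where
  answer : Oracle → Query → Answer
  oracleDist : PMF Oracle
  challengeDist : Oracle → PMF Challenge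
  accept : Oracle → Challenge → Set Outcome

/-- The joint distribution of `K` independent samples from `μ`. -/
noncomputable def iidDist {Ω : Type*} [Fintype Ω] (μ : PMF Ω) (K : ℕ) : PMF (Fin K → Ω) :=
  PMF.ofFintype (fun g => ∏ i, μ (g i)) (by
    classical
    have h : ∑ ω, μ ω = 1 := by rw [← tsum_fintype (L := .unconditional _), μ.tsum_coe]
    rw [← Fintype.piFinset_univ, Finset.sum_prod_piFinset]
    simp [h])

namespace Game

variable {Oracle Query Answer Challenge Outcome : Type*}

/-- The probability that a (randomized) algorithm wins the game. The algorithm gets the string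
`advice f`, where `f` is the sampled oracle, and the challenge; its internal randomness selects a
deterministic query algorithm, which is then run with oracle access to `f`. -/
noncomputable def winProb {Advice : Type*} (G : Game Oracle Query Answer Challenge Outcome)
    (advice : Oracle → Advice)
    (A : Advice → Challenge → PMF (QueryAlg Query Answer Outcome)) : ℝ≥0∞ :=
  (G.oracleDist.bind fun f =>
    (G.challengeDist f).bind fun ch =>
      (A (advice f) ch).map fun a => (a.run (G.answer f) ∈ G.accept f ch)) True

/-- The optimal winning probability of algorithms with at most `T` queries and no advice. -/
noncomputable def eps (G : Game Oracle Query Answer Challenge Outcome) (T : ℕ) : ℝ≥0∞ :=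
  ⨆ (A : Challenge → PMF (QueryAlg Query Answer Outcome))
    (_ : ∀ ch, ∀ a ∈ (A ch).support, a.MakesAtMost T),
    G.winProb (fun _ => ()) (fun _ => A)

/-- The optimal winning probability of algorithms with at most `T` queries and with `S` bits of
advice, which may depend arbitrarily on the oracle (but not on the challenge). -/
noncomputable def epsAdvice (G : Game Oracle Query Answer Challenge Outcome) (S T : ℕ) : ℝ≥0∞ :=
  ⨆ (advice : Oracle → (Fin S → Bool))
    (A : (Fin S → Bool) → Challenge → PMF (QueryAlg Query Answer Outcome))
    (_ : ∀ s ch, ∀ a ∈ (A s ch).support, a.MakesAtMost T),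
    G.winProb advice A

/-- The salted game: the oracle consists of `K` independent samples `g 0, …, g (K - 1)` of the
oracle of `G`, each query names the copy that it is addressed to, and the challenge is a uniformly
random salt `k` together with a challenge of `G` for the copy `g k`, which has to be won. -/
noncomputable def salted [Fintype Oracle] (G : Game Oracle Query Answer Challenge Outcome)
    (K : ℕ) [NeZero K] :
    Game (Fin K → Oracle) (Fin K × Query) Answer (Fin K × Challenge) Outcome where
  answer g q := G.answer (g q.1) q.2
  oracleDist := iidDist G.oracleDist K
  challengeDist g :=
    (PMF.uniformOfFintype (Fin K)).bind fun k => (G.challengeDist (g k)).map fun ch => (k, ch)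
  accept g ch := G.accept (g ch.1) ch.2

end Game

/-! Fix an advice string. Given the oracles `g`, the winning probability is the mean over salts `k`
of `saltWin A k g`. By Jensen and a sum over all `2^S` strings (`ENNReal.sum_mul_advice_le`), it
suffices to bound the `L`-th moment of this mean without advice by `(ε + L/K)^L`, where `ε = G.eps
T`. Expanding the power draws `L` independent salts: a draw repeats an earlier one with probability
at most `L/K`, and a new salt costs a factor `ε` (`ENNReal.sum_mul_prod_mul_mean_pow_le`).

That factor is a direct product theorem (`sum_prod_saltWin_le`): winning on distinct salts `D` has
probability at most `ε^|D|`, although each algorithm may query every copy. Once challenges and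
randomness are fixed, this is `forest_le` for decision trees, one per copy. Each unfinished tree
points to the copy that it queries next. Some set of trees can be advanced together so that every
copy receives at most one query, and a queried copy either has its own tree advanced, which frees
one query of its budget to pay for the answer, or has a stopped tree, to which the answer is
useless. -/

namespace QueryAlg

variable {Query Answer Outcome : Type*}

/-! ### Advancing a query algorithm by one query. -/

theorem MakesAtMost.mono {t : QueryAlg Query Answer Outcome} {m n : ℕ}
    (h : t.MakesAtMost m) (hmn : m ≤ n) : t.MakesAtMost n := by
  induction t generalizing m n with
  | output o => cases n <;> trivial
  | query q next ih =>
    cases m with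
    | zero => exact h.elim
    | succ m =>
      obtain ⟨n, rfl⟩ : ∃ k, n = k + 1 := ⟨n - 1, by omega⟩
      exact fun a => ih a (h a) (by omega)

/-- The first query of the algorithm, if it makes one. -/
def firstQuery : QueryAlg Query Answer Outcome → Option Query
  | output _ => none
  | query q _ => some q

/-- What remains of the algorithm after its first query has been answered. -/
def advance : QueryAlg Query Answer Outcome → Answer → QueryAlg Query Answer Outcome
  | output o, _ => output o
  | query _ next, a => next a

theorem run_advance {t : QueryAlg Query Answer Outcome} {q : Query}
    (h : t.firstQuery = some q) (f : Query → Answer) : (t.advance (f q)).run f = t.run f := by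
  cases t with
  | output o => simp [firstQuery] at h
  | query q' next =>
    obtain rfl : q' = q := by simpa [firstQuery] using h
    rfl

theorem MakesAtMost.pos {t : QueryAlg Query Answer Outcome} {q : Query} {T : ℕ}
    (hT : t.MakesAtMost T) (h : t.firstQuery = some q) : 0 < T := by
  cases t with
  | output o => simp [firstQuery] at h
  | query q' next =>
    cases T with
    | zero => exact hT.elim
    | succ T => exact T.succ_pos

theorem MakesAtMost.advance {t : QueryAlg Query Answer Outcome} {q : Query} {T : ℕ}
    (hT : t.MakesAtMost T) (h : t.firstQuery = some q) (a : Answer) :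
    (t.advance a).MakesAtMost (T - 1) := by
  cases t with
  | output o => simp [firstQuery] at h
  | query q' next =>
    cases T with
    | zero => exact hT.elim
    | succ T => exact hT a

/-! ### Optimal payoffs against a single oracle. -/

section Value

variable {Oracle : Type*} [Fintype Oracle] (ans : Oracle → Query → Answer)

/-- The optimal expected payoff of query algorithms with at most `T` queries, where the payoff of
outcome `o` for oracle `f` is `u f o` (with the probability of `f` absorbed into `u`). -/
noncomputable def value (u : Oracle → Outcome → ℝ≥0∞) (T : ℕ) : ℝ≥0∞ :=
  ⨆ t : {t : QueryAlg Query Answer Outcome // t.MakesAtMost T}, ∑ f, u f (t.1.run (ans f))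

/-- The optimal expected payoff `value ans u T`, except that it is replaced by the expected payoff
of the given algorithm when this has stopped. -/
noncomputable def treeBound {Query' : Type*} (u : Oracle → Outcome → ℝ≥0∞) (T : ℕ) :
    QueryAlg Query' Answer Outcome → ℝ≥0∞
  | output o => ∑ f, u f o
  | query _ _ => value ans u T

theorem le_value (u : Oracle → Outcome → ℝ≥0∞) {T : ℕ} {t : QueryAlg Query Answer Outcome}
    (ht : t.MakesAtMost T) : ∑ f, u f (t.run (ans f)) ≤ value ans u T :=
  le_iSup (fun t : {t : QueryAlg Query Answer Outcome // t.MakesAtMost T} =>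
    ∑ f, u f (t.1.run (ans f))) ⟨t, ht⟩

theorem treeBound_le_value {Query' : Type*} (u : Oracle → Outcome → ℝ≥0∞) (T : ℕ)
    (t : QueryAlg Query' Answer Outcome) : treeBound ans u T t ≤ value ans u T := by
  cases t with
  | output o => exact le_value ans u (t := output o) (by cases T <;> trivial)
  | query q next => exact le_rfl

end Value

end QueryAlg

/-! ### Exchanging sums with suprema and products. -/

/-- The choices at different `x` are independent, so any two choice functions are dominated by
taking the better one pointwise. This glues the best algorithms for each answer or challenge into
one. -/
theorem ENNReal.sum_iSup_le {α τ : Type*} (s : Finset α) (F : α → τ → ℝ≥0∞) :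
    ∑ x ∈ s, ⨆ t, F x t ≤ ⨆ c : α → τ, ∑ x ∈ s, F x (c x) := by
  rw [← ENNReal.finsetSum_iSup]
  · exact Finset.sum_le_sum fun x _ => iSup_le fun t =>
      le_iSup (fun c : α → τ => F x (c x)) fun _ => t
  · intro c d
    classical
    refine ⟨fun x => if F x (c x) ≤ F x (d x) then d x else c x, fun x => ?_⟩
    dsimp only
    split_ifs with h
    · exact ⟨h, le_rfl⟩
    · exact ⟨le_rfl, (not_le.1 h).le⟩

theorem ENNReal.tsum_iSup_le {α τ : Type*} (F : α → τ → ℝ≥0∞) :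
    ∑' x, ⨆ t, F x t ≤ ⨆ c : α → τ, ∑' x, F x (c x) := by
  rw [ENNReal.tsum_eq_iSup_sum]
  exact iSup_le fun s => (ENNReal.sum_iSup_le s F).trans
    (iSup_mono fun c => ENNReal.sum_le_tsum s)

/-- Averages of products of mixtures are bounded as soon as they are bounded for all choices of
the components. -/
theorem ENNReal.sum_mul_prod_tsum_le {ι Ω I : Type*} [Fintype Ω] [Nonempty I]
    (D : Finset ι) (φ : ι → I → Ω → ℝ≥0∞) (v : ι → I → ℝ≥0∞) (c : Ω → ℝ≥0∞) (r : ℝ≥0∞)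
    (h : ∀ i : ι → I, ∑ ω, c ω * ∏ k ∈ D, φ k (i k) ω ≤ r * ∏ k ∈ D, v k (i k)) :
    ∑ ω, c ω * ∏ k ∈ D, ∑' x, φ k x ω ≤ r * ∏ k ∈ D, ∑' x, v k x := by
  classical
  obtain ⟨x₀⟩ := ‹Nonempty I›
  induction D using Finset.induction_on generalizing c r with
  | empty => simpa using h fun _ => x₀
  | insert k D hk ih =>
    simp only [Finset.prod_insert hk] at h ⊢
    calc ∑ ω, c ω * ((∑' x, φ k x ω) * ∏ k ∈ D, ∑' x, φ k x ω)
        = ∑' x, ∑ ω, (c ω * φ k x ω) * ∏ k ∈ D, ∑' x, φ k x ω := by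
          rw [Summable.tsum_finsetSum fun _ _ => ENNReal.summable]
          refine Finset.sum_congr rfl fun ω _ => ?_
          rw [ENNReal.tsum_mul_right, ENNReal.tsum_mul_left, mul_assoc]
      _ ≤ ∑' x, (r * v k x) * ∏ k ∈ D, ∑' x, v k x := by
          refine ENNReal.tsum_le_tsum fun x => ih _ _ fun i => ?_
          -- As `k ∉ D`, fixing component `k` does not affect the product over `D`.
          have := h (Function.update i k x)
          simp only [Function.update_self] at this
          have e (g : ι → I → ℝ≥0∞) :
              ∏ j ∈ D, g j (Function.update i k x j) = ∏ j ∈ D, g j (i j) :=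
            Finset.prod_congr rfl fun j hj => by
              rw [Function.update_of_ne (ne_of_mem_of_not_mem hj hk)]
          have e' (ω : Ω) := e fun j x => φ j x ω
          simpa only [mul_assoc, e, e'] using this
      _ = r * ((∑' x, v k x) * ∏ k ∈ D, ∑' x, v k x) := by
          rw [ENNReal.tsum_mul_right, ENNReal.tsum_mul_left, mul_assoc]

/-! ### Decision forests. -/

namespace QueryAlg

variable {Query Answer Outcome : Type*}

variable {Oracle : Type*} (ans : Oracle → Query → Answer)

open Classical in
/-- The payoff `u` restricted to the oracles with a given answer to an optional query. -/
noncomputable def condPayoff (u : Oracle → Outcome → ℝ≥0∞) (q : Option Query) (x : Option Answer)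
    (f : Oracle) (o : Outcome) : ℝ≥0∞ :=
  if q.map (ans f) = x then u f o else 0

theorem condPayoff_none (u : Oracle → Outcome → ℝ≥0∞) :
    condPayoff ans u none none = u := by
  ext f o; simp [condPayoff]

variable [Fintype Oracle]

open Classical in
/-- The possible answers to an optional query. -/
noncomputable def answers (q : Option Query) : Finset (Option Answer) :=
  Finset.univ.image fun f => q.map (ans f)

theorem mem_answers (q : Option Query) (f : Oracle) : q.map (ans f) ∈ answers ans q := by
  classical exact Finset.mem_image_of_mem _ (Finset.mem_univ f)

theorem answers_none_subset : answers ans none ⊆ {none} := by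
  intro x; simp only [answers, Finset.mem_image]; rintro ⟨f, -, rfl⟩; simp

theorem sum_condPayoff (u : Oracle → Outcome → ℝ≥0∞) (q : Option Query)
    (o : Option Answer → Oracle → Outcome) :
    ∑ x ∈ answers ans q, ∑ f, condPayoff ans u q x f (o x f) =
      ∑ f, u f (o (q.map (ans f)) f) := by
  classical
  rw [Finset.sum_comm]
  refine Finset.sum_congr rfl fun f _ => ?_
  simp only [condPayoff]
  rw [Finset.sum_ite_eq, if_pos (mem_answers ans q f)]

/-- Answering one query for free is no better than having one more query. -/
theorem sum_value_condPayoff_le (u : Oracle → Outcome → ℝ≥0∞) (q : Option Query) (T : ℕ) :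
    ∑ x ∈ answers ans q, value ans (condPayoff ans u q x) T ≤ value ans u (T + 1) := by
  refine (ENNReal.sum_iSup_le _ _).trans (iSup_le fun c => ?_)
  rw [sum_condPayoff ans u q fun x f => (c x).1.run (ans f)]
  cases q with
  | none => exact le_value ans u ((c none).2.mono T.le_succ)
  | some q => exact le_value ans u (t := query q fun a => (c (some a)).1) fun a => (c (some a)).2

/-- A stopped tree cannot exploit an answer: its payoff merely splits over the possible answers.
This is why `treeBound` distinguishes stopped trees, whose copies may be queried without any budget
to pay for it. -/
theorem sum_treeBound_condPayoff_le {Query' : Type*} (u : Oracle → Outcome → ℝ≥0∞)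
    (q : Option Query) (T : ℕ) (t : QueryAlg Query' Answer Outcome)
    (h : q = none ∨ t.firstQuery = none) :
    ∑ x ∈ answers ans q, treeBound ans (condPayoff ans u q x) T t ≤ treeBound ans u T t := by
  rcases h with rfl | h
  · refine (Finset.sum_le_sum_of_subset (answers_none_subset ans)).trans ?_
    rw [Finset.sum_singleton, condPayoff_none]
  · cases t with
    | output o => exact (sum_condPayoff ans u q fun _ _ => o).le
    | query q next => simp [firstQuery] at h

variable {ι : Type*}

/-- For a finite family of pointers `σ` on a set `N` of vertices there is a nonempty subset on
which `σ` is injective and which it maps to itself or out of `N`. -/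
theorem exists_injOn_pointers (σ : ι → ι) (N : Finset ι) (hN : N.Nonempty) :
    ∃ C ⊆ N, C.Nonempty ∧ Set.InjOn σ C ∧ ∀ j ∈ C, σ j ∈ C ∨ σ j ∉ N := by
  classical
  by_cases h : ∃ j ∈ N, σ j ∉ N
  · obtain ⟨j, hj, hσ⟩ := h
    exact ⟨{j}, by simpa using hj, by simp, by simp, by simp [hσ]⟩
  push Not at h
  -- The image of a closed set is closed, so `σ` cannot shrink a smallest nonempty closed set and is
  -- injective on it.
  obtain ⟨C, hC, hmin⟩ := Finset.exists_min_image
    (N.powerset.filter fun C => C.Nonempty ∧ ∀ j ∈ C, σ j ∈ C) Finset.card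
    ⟨N, by simpa using ⟨hN, h⟩⟩
  simp only [Finset.mem_filter, Finset.mem_powerset] at hC hmin
  obtain ⟨hCN, hne, hcl⟩ := hC
  refine ⟨C, hCN, hne, ?_, fun j hj => .inl (hcl j hj)⟩
  have hsub : C.image σ ⊆ C := Finset.image_subset_iff.2 hcl
  refine Finset.card_image_iff.1 (le_antisymm Finset.card_image_le (hmin _ ⟨hsub.trans hCN,
    hne.image σ, fun j hj => Finset.mem_image_of_mem σ (hsub hj)⟩))

variable [Fintype ι]

/-- One round of simultaneous queries: the copies of the oracle in question are conditioned on
the answers. -/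
theorem forest_step [DecidableEq ι] (u : ι → Oracle → Outcome → ℝ≥0∞)
    (B : ι → QueryAlg (ι × Query) Answer Outcome) (C : Finset ι) (r : ι → ι × Query)
    (asked : ι → Option Query) (hr : ∀ j ∈ C, (B j).firstQuery = some (r j))
    (hasked : ∀ j ∈ C, asked (r j).1 = some (r j).2) :
    ∑ g : ι → Oracle, ∏ j, u j (g j) ((B j).run fun q => ans (g q.1) q.2) ≤
      ∑ a ∈ Fintype.piFinset fun i => answers ans (asked i), ∑ g : ι → Oracle,
        ∏ j, condPayoff ans (u j) (asked j) (a j) (g j)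
          ((if j ∈ C then (a (r j).1).elim (B j) (B j).advance else B j).run
            fun q => ans (g q.1) q.2) := by
  rw [Finset.sum_comm]
  refine Finset.sum_le_sum fun g _ => ?_
  -- Keep only the term where `a` is the vector of true answers.
  refine le_trans (le_of_eq ?_) (Finset.single_le_sum (fun _ _ => zero_le)
    (Fintype.mem_piFinset.2 fun i => mem_answers ans (asked i) (g i)))
  refine Finset.prod_congr rfl fun j _ => ?_
  rw [condPayoff, if_pos rfl]
  split_ifs with hj
  · rw [hasked j hj, Option.map_some, Option.elim_some]
    rw [run_advance (hr j hj) fun q => ans (g q.1) q.2]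
  · rfl

/-- Decision forests: algorithms which each play one of several independent games, and which may
address their queries to the oracles of all the games, are no better than independent ones. -/
theorem forest_le [DecidableEq ι] (n : ℕ) (u : ι → Oracle → Outcome → ℝ≥0∞)
    (B : ι → QueryAlg (ι × Query) Answer Outcome) (T : ι → ℕ) (hT : ∀ j, (B j).MakesAtMost (T j))
    (hn : ∑ j, T j = n) :
    ∑ g : ι → Oracle, ∏ j, u j (g j) ((B j).run fun q => ans (g q.1) q.2) ≤
      ∏ j, treeBound ans (u j) (T j) (B j) := by
  classical
  induction n using Nat.strong_induction_on generalizing u B T with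
  | _ n ih =>
  by_cases hleaf : ∀ j, (B j).firstQuery = none
  · have : ∀ j, ∃ o, B j = output o := fun j => by
      specialize hleaf j
      cases h : B j with
      | output o => exact ⟨o, rfl⟩
      | query q next => simp [h, firstQuery] at hleaf
    choose o ho using this
    obtain rfl : B = fun j => output (o j) := funext ho
    simp only [run, treeBound]
    rw [Finset.prod_univ_sum, Fintype.piFinset_univ]
  push Not at hleaf
  obtain ⟨j₀, hj₀⟩ := hleaf
  obtain ⟨r₀, -⟩ := Option.ne_none_iff_exists'.1 hj₀
  -- The default `r₀` is irrelevant: `r` only matters on unfinished trees.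
  let r : ι → ι × Query := fun j => (B j).firstQuery.getD r₀
  let N : Finset ι := Finset.univ.filter fun j => (B j).firstQuery ≠ none
  obtain ⟨C, hCN, hne, hinj, hC⟩ := exists_injOn_pointers
    (fun j => (r j).1) N ⟨j₀, by simp [N, hj₀]⟩
  have hr : ∀ j ∈ C, (B j).firstQuery = some (r j) := fun j hj => by
    obtain ⟨q, hq⟩ := Option.ne_none_iff_exists'.1 (Finset.mem_filter.1 (hCN hj)).2
    simp [r, hq]
  -- Injectivity of the pointers on `C` makes the chosen `j` unique.
  let asked : ι → Option Query := fun i =>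
    if h : ∃ j ∈ C, (r j).1 = i then some (r h.choose).2 else none
  have hasked : ∀ j ∈ C, asked (r j).1 = some (r j).2 := fun j hj => by
    have h : ∃ j' ∈ C, (r j').1 = (r j).1 := ⟨j, hj, rfl⟩
    have : h.choose = j := hinj h.choose_spec.1 hj h.choose_spec.2
    simp only [asked, dif_pos h, this]
  -- A copy queried from `C` but outside `C` lies outside `N`, so its tree has stopped.
  have hasked' : ∀ i ∉ C, asked i = none ∨ (B i).firstQuery = none := fun i hi => by
    by_cases h : ∃ j ∈ C, (r j).1 = i
    · obtain ⟨j, hj, rfl⟩ := h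
      exact .inr (by simpa [N] using (hC j hj).resolve_left hi)
    · exact .inl (dif_neg h)
  let T' : ι → ℕ := fun j => if j ∈ C then T j - 1 else T j
  have hpos : ∀ j ∈ C, 0 < T j := fun j hj => (hT j).pos (hr j hj)
  have hlt : ∑ j, T' j < n := by
    rw [← hn]
    obtain ⟨j, hj⟩ := hne
    refine Finset.sum_lt_sum (fun i _ => ?_) ⟨j, Finset.mem_univ j, ?_⟩
    · simp only [T']; split_ifs <;> omega
    · have := hpos j hj
      simp only [T', if_pos hj]; omega
  let W : ι → Option Answer → ℝ≥0∞ := fun j x =>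
    if j ∈ C then value ans (condPayoff ans (u j) (asked j) x) (T j - 1)
    else treeBound ans (condPayoff ans (u j) (asked j) x) (T j) (B j)
  calc _ ≤ _ := forest_step ans u B C r asked hr hasked
    _ ≤ ∑ a ∈ Fintype.piFinset fun i => answers ans (asked i), ∏ j, W j (a j) := by
      refine Finset.sum_le_sum fun a ha => (ih _ hlt _ _ T' (fun j => ?_) rfl).trans
        (Finset.prod_le_prod' fun j _ => ?_)
      · simp only [T']
        split_ifs with hj
        -- The queried copy has an actual answer, so the fallback `B j` of `elim` does not occur.
        · have := Fintype.mem_piFinset.1 ha (r j).1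
          rw [hasked j hj, answers, Finset.mem_image] at this
          obtain ⟨f, -, hf⟩ := this
          rw [← hf]
          exact (hT j).advance (hr j hj) _
        · exact hT j
      · simp only [W, T']
        split_ifs with hj
        · exact treeBound_le_value ans _ _ _
        · exact le_rfl
    _ = ∏ j, ∑ x ∈ answers ans (asked j), W j x := (Finset.prod_univ_sum _ _).symm
    _ ≤ ∏ j, treeBound ans (u j) (T j) (B j) := by
      refine Finset.prod_le_prod' fun j _ => ?_
      simp only [W]
      split_ifs with hj
      · refine (sum_value_condPayoff_le ans _ _ _).trans (le_of_eq ?_)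
        rw [Nat.sub_add_cancel (hpos j hj)]
        have := hr j hj
        cases h : B j with
        | output o => simp [h, firstQuery] at this
        | query q next => rfl
      · exact sum_treeBound_condPayoff_le ans _ _ _ _ (hasked' j hj)

end QueryAlg

/-! ### The direct product theorem for salted copies. -/

namespace Game

open QueryAlg

variable {Oracle Query Answer Challenge Outcome : Type*}

open Classical in
/-- The indicator of the event that an outcome is accepted. -/
noncomputable def wins (G : Game Oracle Query Answer Challenge Outcome) (f : Oracle)
    (ch : Challenge) (o : Outcome) : ℝ≥0∞ :=
  if o ∈ G.accept f ch then 1 else 0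

theorem wins_le_one (G : Game Oracle Query Answer Challenge Outcome) (f : Oracle)
    (ch : Challenge) (o : Outcome) : G.wins f ch o ≤ 1 := by
  unfold wins; split_ifs <;> simp

theorem map_accept_apply (G : Game Oracle Query Answer Challenge Outcome) (f : Oracle)
    (ch : Challenge) (p : PMF (QueryAlg Query Answer Outcome)) :
    p.map (fun a => (a.run (G.answer f) ∈ G.accept f ch)) True =
      ∑' a, p a * G.wins f ch (a.run (G.answer f)) := by
  rw [PMF.map_apply]
  refine tsum_congr fun a => ?_
  by_cases h : a.run (G.answer f) ∈ G.accept f ch <;> simp [wins, h]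

theorem winProb_le_one {Advice : Type*} (G : Game Oracle Query Answer Challenge Outcome)
    (advice : Oracle → Advice) (A : Advice → Challenge → PMF (QueryAlg Query Answer Outcome)) :
    G.winProb advice A ≤ 1 :=
  PMF.coe_le_one _ _

theorem eps_le_one (G : Game Oracle Query Answer Challenge Outcome) (T : ℕ) : G.eps T ≤ 1 :=
  iSup₂_le fun _ _ => G.winProb_le_one _ _

/-- The probability that an algorithm wins the salted game for given oracles and a given salt. -/
noncomputable def saltWin (G : Game Oracle Query Answer Challenge Outcome) {K : ℕ}
    (A : Fin K × Challenge → PMF (QueryAlg (Fin K × Query) Answer Outcome))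
    (k : Fin K) (g : Fin K → Oracle) : ℝ≥0∞ :=
  ∑' x : Challenge × QueryAlg (Fin K × Query) Answer Outcome,
    G.challengeDist (g k) x.1 *
      (A (k, x.1) x.2 * G.wins (g k) x.1 (x.2.run fun q => G.answer (g q.1) q.2))

theorem saltWin_le_one (G : Game Oracle Query Answer Challenge Outcome) {K : ℕ}
    (A : Fin K × Challenge → PMF (QueryAlg (Fin K × Query) Answer Outcome))
    (k : Fin K) (g : Fin K → Oracle) : G.saltWin A k g ≤ 1 := by
  rw [saltWin, ENNReal.tsum_prod']
  simp only [ENNReal.tsum_mul_left]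
  refine le_trans (ENNReal.tsum_le_tsum fun ch => mul_le_of_le_one_right' ?_)
    (G.challengeDist (g k)).tsum_coe.le
  exact (ENNReal.tsum_le_tsum fun a => mul_le_of_le_one_right' (G.wins_le_one _ _ _)).trans
    (A (k, ch)).tsum_coe.le

variable [Fintype Oracle]

/-- The joint probability of an oracle and a challenge, if the outcome is accepted. -/
noncomputable def payoff (G : Game Oracle Query Answer Challenge Outcome) (ch : Challenge)
    (f : Oracle) (o : Outcome) : ℝ≥0∞ :=
  G.oracleDist f * (G.challengeDist f ch * G.wins f ch o)

/-- Choosing one deterministic tree per challenge defines an algorithm whose winning probability is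
exactly the sum of the payoffs. -/
theorem tsum_value_le_eps (G : Game Oracle Query Answer Challenge Outcome) (T : ℕ) :
    ∑' ch, value G.answer (G.payoff ch) T ≤ G.eps T := by
  refine (ENNReal.tsum_iSup_le _).trans (iSup_le fun c => ?_)
  refine le_trans (le_of_eq ?_) (le_iSup₂ (f := fun (A : Challenge → PMF _) _ =>
    G.winProb (fun _ => ()) (fun _ => A)) (fun ch => PMF.pure (c ch).1) fun ch a ha => ?_)
  · rw [Summable.tsum_finsetSum fun _ _ => ENNReal.summable, winProb, PMF.bind_apply, tsum_fintype]
    refine Finset.sum_congr rfl fun f _ => ?_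
    simp only [payoff, ENNReal.tsum_mul_left]
    rw [PMF.bind_apply]
    congr 1
    refine tsum_congr fun ch => ?_
    rw [map_accept_apply, tsum_eq_single (c ch).1]
    · simp
    · intro a ha; simp [ha]
  · rw [PMF.support_pure, Set.mem_singleton_iff] at ha
    exact ha ▸ (c ch).2

theorem salted_winProb {Advice : Type*} (G : Game Oracle Query Answer Challenge Outcome) {K : ℕ}
    [NeZero K] (advice : (Fin K → Oracle) → Advice)
    (A : Advice → Fin K × Challenge → PMF (QueryAlg (Fin K × Query) Answer Outcome)) :
    (G.salted K).winProb advice A = ∑ g, iidDist G.oracleDist K g *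
      ((K : ℝ≥0∞)⁻¹ * ∑ k, G.saltWin (A (advice g)) k g) := by
  rw [winProb, PMF.bind_apply, tsum_fintype]
  refine Finset.sum_congr rfl fun g _ => ?_
  rw [show (G.salted K).oracleDist = iidDist G.oracleDist K from rfl]
  congr 1
  rw [show (G.salted K).challengeDist g = (PMF.uniformOfFintype (Fin K)).bind fun k =>
    (G.challengeDist (g k)).map fun ch => (k, ch) from rfl]
  simp only [PMF.bind_bind, PMF.bind_map]
  rw [PMF.bind_apply, tsum_fintype, Finset.mul_sum]
  refine Finset.sum_congr rfl fun k _ => ?_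
  rw [PMF.uniformOfFintype_apply, Fintype.card_fin, PMF.bind_apply, saltWin, ENNReal.tsum_prod']
  congr 1
  refine tsum_congr fun ch => ?_
  dsimp only
  rw [ENNReal.tsum_mul_left]
  congr 1
  exact map_accept_apply (G.salted K) g (k, ch) _

theorem iidDist_apply (μ : PMF Oracle) (K : ℕ) (g : Fin K → Oracle) :
    iidDist μ K g = ∏ k, μ (g k) := rfl

/-- Winning several copies of the game with fixed challenges. -/
theorem sum_prod_wins_le (G : Game Oracle Query Answer Challenge Outcome) {K T : ℕ}
    (D : Finset (Fin K)) (ch : Fin K → Challenge)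
    (B : Fin K → QueryAlg (Fin K × Query) Answer Outcome) (hB : ∀ k ∈ D, (B k).MakesAtMost T)
    (o : Outcome) :
    ∑ g, iidDist G.oracleDist K g * ∏ k ∈ D, (G.challengeDist (g k) (ch k) *
        G.wins (g k) (ch k) ((B k).run fun q => G.answer (g q.1) q.2)) ≤
      ∏ k ∈ D, value G.answer (G.payoff (ch k)) T := by
  -- Copies outside `D` get payoff of total mass one and a tree that stops at once, so that the
  -- forest bound applies to all `K` copies.
  let u : Fin K → Oracle → Outcome → ℝ≥0∞ := fun k f o => G.oracleDist f *
    if k ∈ D then G.challengeDist f (ch k) * G.wins f (ch k) o else 1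
  let B' : Fin K → QueryAlg (Fin K × Query) Answer Outcome := fun k =>
    if k ∈ D then B k else output o
  have hB' : ∀ k, (B' k).MakesAtMost T := fun k => by
    simp only [B']
    split_ifs with hk
    · exact hB k hk
    · cases T <;> trivial
  calc _ = ∑ g : Fin K → Oracle, ∏ k, u k (g k) ((B' k).run fun q => G.answer (g q.1) q.2) := by
        refine Finset.sum_congr rfl fun g _ => ?_
        simp only [u, Finset.prod_mul_distrib (f := fun k => G.oracleDist (g k)), iidDist_apply]
        rw [Finset.prod_ite_mem, Finset.univ_inter]
        congr 1
        exact Finset.prod_congr rfl fun k hk => by simp only [B', if_pos hk]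
    _ ≤ ∏ k, treeBound G.answer (u k) T (B' k) :=
        forest_le G.answer _ u B' (fun _ => T) hB' rfl
    _ ≤ ∏ k, if k ∈ D then value G.answer (G.payoff (ch k)) T else 1 := by
        refine Finset.prod_le_prod' fun k _ => ?_
        refine (treeBound_le_value _ _ _ _).trans ?_
        split_ifs with hk
        · simp only [u, if_pos hk]; rfl
        · refine iSup_le fun t => ?_
          simp only [u, if_neg hk, mul_one]
          rw [← tsum_fintype (L := .unconditional _), PMF.tsum_coe]
    _ = _ := by rw [Finset.prod_ite_mem, Finset.univ_inter]

/-- Direct product theorem: winning all copies of the game in `D`. -/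
theorem sum_prod_saltWin_le (G : Game Oracle Query Answer Challenge Outcome) {K T : ℕ}
    (A : Fin K × Challenge → PMF (QueryAlg (Fin K × Query) Answer Outcome))
    (hA : ∀ ch, ∀ a ∈ (A ch).support, a.MakesAtMost T) (o : Outcome) (D : Finset (Fin K)) :
    ∑ g, iidDist G.oracleDist K g * ∏ k ∈ D, G.saltWin A k g ≤ G.eps T ^ D.card := by
  classical
  obtain ⟨f₀, -⟩ := G.oracleDist.support_nonempty
  obtain ⟨ch₀, -⟩ := (G.challengeDist f₀).support_nonempty
  have : Nonempty (Challenge × QueryAlg (Fin K × Query) Answer Outcome) := ⟨(ch₀, output o)⟩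
  refine (ENNReal.sum_mul_prod_tsum_le D _
    (fun k x => A (k, x.1) x.2 * value G.answer (G.payoff x.1) T) _ 1 fun i => ?_).trans ?_
  · simp only [one_mul, mul_left_comm (G.challengeDist _ _), Finset.prod_mul_distrib (s := D)
      (f := fun k => A (k, (i k).1) (i k).2), mul_left_comm (iidDist _ _ _), ← Finset.mul_sum]
    -- The query bound holds only on the support; off the support both sides vanish.
    by_cases h : ∀ k ∈ D, A (k, (i k).1) (i k).2 ≠ 0
    · gcongr
      exact G.sum_prod_wins_le D (fun k => (i k).1) (fun k => (i k).2)
        (fun k hk => hA _ _ ((PMF.mem_support_iff _ _).2 (h k hk))) o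
    · push Not at h
      obtain ⟨k, hk, h0⟩ := h
      rw [Finset.prod_eq_zero hk h0, zero_mul, zero_mul]
  · rw [one_mul, ← Finset.prod_const]
    refine Finset.prod_le_prod' fun k _ => ?_
    rw [ENNReal.tsum_prod']
    simp only [ENNReal.tsum_mul_right, PMF.tsum_coe, one_mul]
    exact G.tsum_value_le_eps T

end Game

/-! ### Moments, advice and the final bound. -/

/-- If the average of the product of the `w k` over any set of indices `k` is at most `ε` to the
size of the set, then moments of the mean of the `w k` are bounded up to collisions. -/
theorem ENNReal.sum_mul_prod_mul_mean_pow_le {Ω : Type*} [Fintype Ω] {K : ℕ} [NeZero K]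
    (μ : Ω → ℝ≥0∞) (w : Fin K → Ω → ℝ≥0∞) (hw : ∀ k ω, w k ω ≤ 1) (ε : ℝ≥0∞)
    (h : ∀ D : Finset (Fin K), ∑ ω, μ ω * ∏ k ∈ D, w k ω ≤ ε ^ D.card) (L m : ℕ)
    (D : Finset (Fin K)) (hD : D.card + m ≤ L) :
    ∑ ω, μ ω * ((∏ k ∈ D, w k ω) * ((K : ℝ≥0∞)⁻¹ * ∑ k, w k ω) ^ m) ≤
      ε ^ D.card * (ε + L / K) ^ m := by
  classical
  induction m generalizing D with
  | zero => simpa using h D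
  | succ m ih =>
    set b := (ε + L / K) ^ m
    have hK : (K : ℝ≥0∞)⁻¹ * K = 1 :=
      ENNReal.inv_mul_cancel (by simp [NeZero.ne K]) (by simp)
    calc _ = (K : ℝ≥0∞)⁻¹ * ∑ k, ∑ ω, μ ω * ((w k ω * ∏ k ∈ D, w k ω) *
              ((K : ℝ≥0∞)⁻¹ * ∑ k, w k ω) ^ m) := by
          rw [Finset.sum_comm, Finset.mul_sum]
          refine Finset.sum_congr rfl fun ω _ => ?_
          rw [← Finset.mul_sum, ← Finset.sum_mul, ← Finset.sum_mul, pow_succ]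
          ring
      _ ≤ (K : ℝ≥0∞)⁻¹ * ∑ k, ((if k ∈ D then ε ^ D.card * b else 0) + ε ^ (D.card + 1) * b) := by
          gcongr with k
          -- A repeated salt: drop the extra factor `w k ≤ 1`. A new salt: enlarge `D`.
          split_ifs with hk
          · refine le_add_right (le_trans ?_ (ih D (by omega)))
            gcongr with ω
            exact mul_le_of_le_one_left' (hw k ω)
          · rw [zero_add, ← Finset.card_insert_of_notMem hk]
            refine le_trans (le_of_eq ?_) (ih _ (by rw [Finset.card_insert_of_notMem hk]; omega))
            exact Finset.sum_congr rfl fun ω _ => by rw [Finset.prod_insert hk]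
      _ = (K : ℝ≥0∞)⁻¹ * (D.card * (ε ^ D.card * b)) +
            ((K : ℝ≥0∞)⁻¹ * K) * (ε ^ (D.card + 1) * b) := by
          rw [Finset.sum_add_distrib, Finset.sum_ite_mem, Finset.univ_inter, Finset.sum_const,
            Finset.sum_const, Finset.card_univ, Fintype.card_fin, nsmul_eq_mul, nsmul_eq_mul]
          ring
      _ = ε ^ D.card * (b * (ε + D.card / K)) := by
          rw [hK, div_eq_mul_inv]; ring
      -- The collision probability `|D|/K` is at most `L/K`, by `hD`.
      _ ≤ ε ^ D.card * (ε + L / K) ^ (m + 1) := by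
          rw [pow_succ]
          gcongr
          omega

/-- Averages with advice are bounded in terms of moments without advice. -/
theorem ENNReal.sum_mul_advice_le {Ω σ : Type*} [Fintype Ω] [Fintype σ] (μ : Ω → ℝ≥0∞)
    (hμ : ∑ ω, μ ω = 1) (w : σ → Ω → ℝ≥0∞) (advice : Ω → σ) (b : ℝ≥0∞) {L : ℕ} (hL : 1 ≤ L)
    (h : ∀ s, ∑ ω, μ ω * w s ω ^ L ≤ b ^ L) :
    ∑ ω, μ ω * w (advice ω) ω ≤ (Fintype.card σ : ℝ≥0∞) ^ (1 / (L : ℝ)) * b := by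
  have hL' : (0 : ℝ) < L := by exact_mod_cast hL
  rw [← ENNReal.rpow_le_rpow_iff hL', ENNReal.mul_rpow_of_nonneg _ _ hL'.le, ← ENNReal.rpow_mul,
    one_div_mul_cancel hL'.ne', ENNReal.rpow_one]
  -- Jensen's inequality for the `L`-th power.
  refine (ENNReal.rpow_arith_mean_le_arith_mean_rpow _ _ _ hμ (by exact_mod_cast hL)).trans ?_
  simp only [ENNReal.rpow_natCast]
  calc _ ≤ ∑ ω, ∑ s, μ ω * w s ω ^ L :=
        Finset.sum_le_sum fun ω _ => Finset.single_le_sum (f := fun s => μ ω * w s ω ^ L)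
          (fun _ _ => zero_le) (Finset.mem_univ (advice ω))
    _ ≤ ∑ _s : σ, b ^ L := by
        rw [Finset.sum_comm]
        exact Finset.sum_le_sum fun s _ => h s
    _ = _ := by rw [Finset.sum_const, Finset.card_univ, nsmul_eq_mul]

namespace Game

open QueryAlg

variable {Oracle Query Answer Challenge Outcome : Type*} [Fintype Oracle]

theorem salted_epsAdvice_le (G : Game Oracle Query Answer Challenge Outcome) (K : ℕ) [NeZero K]
    (S T : ℕ) {L : ℕ} (hL : 1 ≤ L) :
    (G.salted K).epsAdvice S T ≤
      (2 : ℝ≥0∞) ^ ((S : ℝ) / (L : ℝ)) * (G.eps T + (L : ℝ≥0∞) / (K : ℝ≥0∞)) := by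
  refine iSup_le fun advice => iSup₂_le fun A hA => ?_
  obtain ⟨f₀, -⟩ := G.oracleDist.support_nonempty
  obtain ⟨ch₀, -⟩ := (G.challengeDist f₀).support_nonempty
  obtain ⟨t₀, -⟩ := (A (fun _ => false) (0, ch₀)).support_nonempty
  let o : Outcome := t₀.run fun q => G.answer f₀ q.2
  have hμ : ∑ g, iidDist G.oracleDist K g = 1 := by
    rw [← tsum_fintype (L := .unconditional _), PMF.tsum_coe]
  rw [salted_winProb]
  refine (ENNReal.sum_mul_advice_le _ hμ
    (fun s g => (K : ℝ≥0∞)⁻¹ * ∑ k, G.saltWin (A s) k g) advice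
    (G.eps T + L / K) hL fun s => ?_).trans
    (le_of_eq ?_)
  · simpa using ENNReal.sum_mul_prod_mul_mean_pow_le (iidDist G.oracleDist K) _
      (G.saltWin_le_one (A s)) _ (G.sum_prod_saltWin_le (A s) (hA s) o) L L ∅ (by simp)
  · congr 1
    rw [Fintype.card_fun, Fintype.card_bool, Fintype.card_fin, Nat.cast_pow, Nat.cast_ofNat,
      ← ENNReal.rpow_natCast, ← ENNReal.rpow_mul, mul_one_div]

end Game

/-- A sequence which is finite at `1` and dominates a linear one attains its minimum. -/
theorem ENNReal.exists_isLeast_of_div_le (b : ℕ → ℝ≥0∞) (K : ℕ) (h1 : b 1 ≠ ⊤)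
    (hb : ∀ L : ℕ, 1 ≤ L → (L : ℝ≥0∞) / K ≤ b L) :
    ∃ m, IsLeast {x | ∃ L : ℕ, 1 ≤ L ∧ x = b L} m := by
  -- For `L ≥ N > b 1 * K` the linear lower bound already exceeds `b 1`, so a finite range contains
  -- the minimum.
  obtain ⟨N, hN⟩ := ENNReal.exists_nat_gt (ENNReal.mul_ne_top h1 (ENNReal.natCast_ne_top K))
  obtain ⟨M, hM, hmin⟩ := Finset.exists_min_image (Finset.Icc 1 (N + 1)) b ⟨1, by simp⟩
  refine ⟨b M, ⟨M, (Finset.mem_Icc.1 hM).1, rfl⟩, ?_⟩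
  rintro _ ⟨L, hL, rfl⟩
  rcases le_total L (N + 1) with h | h
  · exact hmin L (Finset.mem_Icc.2 ⟨hL, h⟩)
  · refine (hmin 1 (by simp)).trans (le_trans ?_ (hb L hL))
    rcases eq_or_ne K 0 with rfl | hK
    · simp [ENNReal.div_zero, show L ≠ 0 by omega]
    rw [ENNReal.le_div_iff_mul_le (.inl (by simpa using hK)) (.inl (by simp))]
    exact hN.le.trans (by exact_mod_cast (by omega : N ≤ L))

theorem mainTheorem1 {Oracle Query Answer Challenge Outcome : Type*} [Fintype Oracle]
    (G : Game Oracle Query Answer Challenge Outcome) (K : ℕ) [NeZero K] (S T : ℕ) :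
    ∃ m : ℝ≥0∞,
      IsLeast {b : ℝ≥0∞ | ∃ L : ℕ, 1 ≤ L ∧
        b = (2 : ℝ≥0∞) ^ ((S : ℝ) / (L : ℝ)) * (G.eps T + (L : ℝ≥0∞) / (K : ℝ≥0∞))} m ∧
      (G.salted K).epsAdvice S T ≤ m := by
  let b : ℕ → ℝ≥0∞ := fun L =>
    (2 : ℝ≥0∞) ^ ((S : ℝ) / (L : ℝ)) * (G.eps T + (L : ℝ≥0∞) / (K : ℝ≥0∞))
  have h1 : b 1 ≠ ⊤ := by
    refine ENNReal.mul_ne_top (ENNReal.rpow_ne_top_of_nonneg (by positivity) (by simp))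
      (ENNReal.add_ne_top.2 ⟨((G.eps_le_one T).trans_lt ENNReal.one_lt_top).ne, ?_⟩)
    exact ENNReal.div_ne_top (by simp) (by simp [NeZero.ne K])
  have hb (L : ℕ) (_ : 1 ≤ L) : (L : ℝ≥0∞) / K ≤ b L := by
    have h2 : (1 : ℝ≥0∞) ≤ 2 ^ ((S : ℝ) / (L : ℝ)) := by
      simpa using ENNReal.rpow_le_rpow (one_le_two (α := ℝ≥0∞)) (z := (S : ℝ) / L) (by positivity)
    exact le_add_self.trans (le_mul_of_one_le_left' h2)
  obtain ⟨m, hm⟩ := ENNReal.exists_isLeast_of_div_le b K h1 hb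
  refine ⟨m, hm, ?_⟩
  obtain ⟨L, hL, rfl⟩ := hm.1
  exact G.salted_epsAdvice_le K S T hL
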